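/- Let $A$ be an Artin algebra, i.e. $A$ is a finite algebra over a commutative artinian ring $R$, and let $J$ be its Jacobson radical. Modules are left modules unless said otherwise. Assume that $A$ is minimal Auslander–Gorenstein: the injective dimensions of $A$ as a left and as a right $A$-module are both finite, and $\operatorname{inj\,dim}_A A\le \operatorname{dom\,dim} A$, where, for the minimal injective coresolution $0\to A\to I^0\to I^1\to\cdots$ of the left $A$-module $A$, $\operatorname{dom\,dim} A=\inf\{n\ge 0\mid I^n \text{ is not projective}\}\in\mathbb N\cup\{\infty\}$. For a finitely generated $A$-module $M$ let $\Omega^n(M)$ denote its $n$-th syzygy, that is, $\Omega^0(M)=M$ and $\Omega^{n+1}(M)$ is the kernel of a projective cover of $\Omega^n(M)$. Then $$\operatorname{inj\,dim}_A\Omega^n(A/J)=\operatorname{gl\,dim}A$$ for every integer $n\ge 0$ such that $\Omega^n(A/J)\neq 0$; here both sides may be $\infty$. -/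

import Mathlib

open CategoryTheory

universe u

/-- A linear map `f : P → M` is a projective cover if `P` is projective, `f` is surjective and the
kernel of `f` is a superfluous (small) submodule of `P`. -/
structure IsProjectiveCover {A : Type u} [Ring A] {P M : Type u} [AddCommGroup P] [Module A P]
    [AddCommGroup M] [Module A M] (f : P →ₗ[A] M) : Prop where
  projective : Module.Projective A P
  surjective : Function.Surjective f
  superfluous : ∀ N : Submodule A P, N ⊔ LinearMap.ker f = ⊤ → N = ⊤

/-- `IsSyzygy n M K` says that `K` is (isomorphic to) the `n`-th syzygy `Ωⁿ(M)`: `Ω⁰(M) = M`, and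
`Ωⁿ⁺¹(M)` is the kernel of a projective cover of `Ωⁿ(M)`. -/
def IsSyzygy {A : Type u} [Ring A] : ℕ → ModuleCat.{u} A → ModuleCat.{u} A → Prop
  | 0, M, K => Nonempty (K ≃ₗ[A] M)
  | n + 1, M, K => ∃ (L P : ModuleCat.{u} A) (f : P →ₗ[A] L),
      IsSyzygy n M L ∧ IsProjectiveCover f ∧ Nonempty (K ≃ₗ[A] LinearMap.ker f)

/-- A submodule `N` of `I` is essential if it meets every nonzero submodule of `I`. -/
def IsEssentialSubmodule {A : Type u} [Ring A] {I : Type u} [AddCommGroup I] [Module A I]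
    (N : Submodule A I) : Prop :=
  ∀ K : Submodule A I, K ⊓ N = ⊥ → K = ⊥

/-- A minimal injective coresolution `0 → M → I⁰ → I¹ → ⋯`: an exact sequence with all `Iⁿ`
injective, in which `I⁰` is an injective envelope of the image of `M` and each `Iⁿ⁺¹` is an
injective envelope of the image of `Iⁿ`. -/
structure MinimalInjectiveCoresolution {A : Type u} [Ring A] (M : ModuleCat.{u} A) where
  I : ℕ → ModuleCat.{u} A
  ι : M →ₗ[A] I 0
  d : ∀ n, I n →ₗ[A] I (n + 1)
  injective : ∀ n, Module.Injective A (I n)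
  ι_injective : Function.Injective ι
  exact_zero : Function.Exact ι (d 0)
  exact_succ : ∀ n, Function.Exact (d n) (d (n + 1))
  essential_zero : IsEssentialSubmodule (LinearMap.range ι)
  essential_succ : ∀ n, IsEssentialSubmodule (LinearMap.range (d n))

/-- The dominant dimension of `M`: the infimum in `ℕ ∪ {∞}` of the `n` such that the `n`-th term of
the minimal injective coresolution of `M` is not projective. -/
noncomputable def dominantDimension {A : Type u} [Ring A] (M : ModuleCat.{u} A) : ℕ∞ :=
  sInf {m : ℕ∞ | ∃ n : ℕ, m = n ∧
    ∃ c : MinimalInjectiveCoresolution M, ¬ Module.Projective A (c.I n)}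

/-- The (left) global dimension of `A`: the supremum of the projective dimensions of all left
`A`-modules. The value `⊥` occurs only for the zero ring. -/
noncomputable def globalDimension (A : Type u) [Ring A] : WithBot ℕ∞ :=
  ⨆ M : ModuleCat.{u} A, projectiveDimension M

/-- Iwanaga–Gorenstein rings: noetherian on both sides, and of finite injective dimension as a left
and as a right module over themselves. -/
structure IsIwanagaGorenstein (A : Type u) [Ring A] : Prop where
  noetherian_left : IsNoetherianRing A
  noetherian_right : IsNoetherianRing Aᵐᵒᵖ
  left : injectiveDimension (ModuleCat.of.{u} A A) < ⊤
  right : injectiveDimension (ModuleCat.of.{u} Aᵐᵒᵖ A) < ⊤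

/-- Minimal Auslander–Gorenstein rings: `A` is Gorenstein and `inj dim A ≤ dom dim A`. -/
structure IsMinimalAuslanderGorenstein (A : Type u) [Ring A] : Prop where
  gorenstein : IsIwanagaGorenstein A
  injectiveDimension_le : injectiveDimension (ModuleCat.of.{u} A A) ≤
    ((dominantDimension (ModuleCat.of.{u} A A) : ℕ∞) : WithBot ℕ∞)

/-- Over a left artinian ring every finitely generated module has a projective cover. -/
theorem exists_isProjectiveCover {A : Type u} [Ring A] [IsArtinianRing A] (M : ModuleCat.{u} A)
    [Module.Finite A M] :
    ∃ (P : ModuleCat.{u} A) (f : P →ₗ[A] M), Module.Finite A P ∧ IsProjectiveCover f := by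
  obtain ⟨n, g, hg⟩ := Module.Finite.exists_fin' A M
  have wf : WellFoundedLT (Submodule A (Fin n → A)) := inferInstance
  obtain ⟨N, hN, hmin⟩ := wf.wf.has_min
    {N : Submodule A (Fin n → A) | Submodule.map g N = ⊤}
    ⟨⊤, by simpa [LinearMap.range_eq_top] using hg⟩
  replace hN : Submodule.map g N = ⊤ := hN
  have hfs : Function.Surjective (g.domRestrict N) := by
    intro y
    have hy : y ∈ Submodule.map g N := by rw [hN]; trivial
    obtain ⟨x, hx, rfl⟩ := hy
    exact ⟨⟨x, hx⟩, rfl⟩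
  have key : ∀ K : Submodule A N, Submodule.map (g.domRestrict N) K = ⊤ → K = ⊤ := by
    intro K hK
    have h1 : Submodule.map g (K.map N.subtype) = ⊤ := by
      rw [← Submodule.map_comp, ← hK]; rfl
    have h2 : K.map N.subtype = N := by
      by_contra hne
      exact hmin _ h1 (lt_of_le_of_ne (Submodule.map_subtype_le N K) hne)
    rw [eq_top_iff]
    rintro ⟨x, hx⟩ -
    rw [← h2] at hx
    obtain ⟨y, hy, hyx⟩ := hx
    have : y = ⟨x, by rw [← h2]; exact ⟨y, hy, hyx⟩⟩ := Subtype.ext hyx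
    rwa [this] at hy
  obtain ⟨h, hh⟩ := Module.projective_lifting_property (g.domRestrict N) g hfs
  have hsurj : Function.Surjective (h ∘ₗ N.subtype) := by
    rw [← LinearMap.range_eq_top]
    apply key
    rw [← LinearMap.range_comp, ← LinearMap.comp_assoc, hh]
    exact LinearMap.range_eq_top.2 hfs
  have hbij := IsNoetherian.bijective_of_surjective_endomorphism (h ∘ₗ N.subtype) hsurj
  let e := LinearEquiv.ofBijective _ hbij
  have hproj : Module.Projective A N := by
    refine Module.Projective.of_split (N.subtype ∘ₗ e.symm.toLinearMap) h ?_
    ext x : 1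
    exact e.apply_symm_apply x
  refine ⟨ModuleCat.of A N, g.domRestrict N, inferInstanceAs (Module.Finite A N), hproj, hfs, ?_⟩
  intro K hK
  apply key
  have := congrArg (Submodule.map (g.domRestrict N)) hK
  rw [Submodule.map_sup, Submodule.map_top, LinearMap.range_eq_top.2 hfs] at this
  rw [← this, eq_comm, sup_eq_left]
  rintro _ ⟨x, hx, rfl⟩
  rw [LinearMap.mem_ker.1 hx]
  exact Submodule.zero_mem _

/-- Over a left artinian ring all syzygies of finitely generated modules exist. -/
theorem exists_isSyzygy {A : Type u} [Ring A] [IsArtinianRing A] (M : ModuleCat.{u} A)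
    [Module.Finite A M] (n : ℕ) : ∃ K : ModuleCat.{u} A, Module.Finite A K ∧ IsSyzygy n M K := by
  induction n with
  | zero => exact ⟨M, inferInstance, ⟨LinearEquiv.refl A M⟩⟩
  | succ n ih =>
    obtain ⟨L, hL, hs⟩ := ih
    obtain ⟨P, f, hP, hf⟩ := exists_isProjectiveCover L
    exact ⟨ModuleCat.of A (LinearMap.ker f), inferInstanceAs (Module.Finite A (LinearMap.ker f)),
      L, P, f, hs, hf, ⟨LinearEquiv.refl A _⟩⟩

/-! The upper bound by the global dimension is immediate; the lower bound splits in two. It rests on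
one test: over a left artinian ring a finitely generated $M$ has projective dimension below $n$ as
soon as $\operatorname{Ext}^n(M,A/J)=0$ in that single degree.

If $\operatorname{gl\,dim}A=\infty$ and $\Omega^n(A/J)$ had finite injective dimension, then so
would $A/J$, since the projective covers in between have finite injective dimension like $A$. The
test would bound the projective dimensions of all simple modules, hence the global dimension.

If $\operatorname{gl\,dim}A=d<\infty$, take a simple $S$ of projective dimension $d$. Then
$\operatorname{inj\,dim}A\ge d$, so $I^0,\dots,I^{d-1}$ are projective. An embedding of $S$ in a
projective $Q$ would, for $d>0$, give $Q/S$ projective dimension $d+1$; so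
$\operatorname{Hom}(S,I^k)=0$ for $k<d$, and $\operatorname{Ext}^i(S,A)=0$ for $i<d$
(`ext_self_subsingleton`). Hence the class in $\operatorname{Ext}^{d-n}(S,A/J)\ne0$ survives
dimension shifting to $\operatorname{Ext}^d(S,\Omega^n(A/J))$ (`not_subsingleton_ext`). -/

open Abelian

/-! ### Exact sequences and vanishing of Ext -/

section ShortExactSequences

variable {A : Type u} [Ring A]

theorem shortExact_ofHom {X Y Z : ModuleCat.{u} A} (f : X →ₗ[A] Y) (g : Y →ₗ[A] Z)
    (hf : Function.Injective f) (hfg : Function.Exact f g) (hg : Function.Surjective g) :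
    (ModuleCat.shortComplexOfCompEqZero f g hfg.linearMap_comp_eq_zero).ShortExact :=
  ModuleCat.shortComplex_shortExact _ hfg hf hg

theorem shortExact_mkQ {X Y : ModuleCat.{u} A} (f : X →ₗ[A] Y) (hf : Function.Injective f) :
    (ModuleCat.shortComplexOfCompEqZero (L := Y ⧸ LinearMap.range f) f (LinearMap.range f).mkQ
      f.exact_map_mkQ_range.linearMap_comp_eq_zero).ShortExact :=
  ModuleCat.shortComplex_shortExact _ f.exact_map_mkQ_range hf (Submodule.mkQ_surjective _)

theorem ext_subsingleton_of_retract {X Y Z : ModuleCat.{u} A} (i : Y →ₗ[A] Z) (r : Z →ₗ[A] Y)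
    (h : r ∘ₗ i = LinearMap.id) (n : ℕ) (hZ : Subsingleton (Ext X Z n)) :
    Subsingleton (Ext X Y n) := by
  refine subsingleton_of_forall_eq 0 fun e ↦ ?_
  have hid : ModuleCat.ofHom i ≫ ModuleCat.ofHom r = 𝟙 Y := by
    rw [← ModuleCat.ofHom_comp, h]; rfl
  rw [← e.comp_mk₀_id, ← hid, ← Ext.mk₀_comp_mk₀, ← Ext.comp_assoc_of_third_deg_zero,
    Subsingleton.elim (e.comp (Ext.mk₀ (ModuleCat.ofHom i)) (add_zero n)) 0, Ext.zero_comp]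

theorem ext_subsingleton_congr_right {X Y Z : ModuleCat.{u} A} (e : Y ≃ₗ[A] Z) (n : ℕ) :
    Subsingleton (Ext X Y n) ↔ Subsingleton (Ext X Z n) :=
  ⟨ext_subsingleton_of_retract e.symm.toLinearMap e.toLinearMap (by ext; simp) n,
    ext_subsingleton_of_retract e.toLinearMap e.symm.toLinearMap (by ext; simp) n⟩

/-- If `Extⁿ(X, A)` vanishes, so does `Extⁿ(X, P)` for every finitely generated projective `P`. -/
theorem ext_subsingleton_of_projective {X : ModuleCat.{u} A} {n : ℕ}
    (hX : Subsingleton (Ext X (ModuleCat.of.{u} A A) n)) (P : ModuleCat.{u} A)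
    [Module.Finite A P] [Module.Projective A P] : Subsingleton (Ext X P n) := by
  obtain ⟨k, g, hg⟩ := Module.Finite.exists_fin' A P
  obtain ⟨s, hs⟩ := Module.projective_lifting_property g LinearMap.id hg
  refine ext_subsingleton_of_retract (Z := ModuleCat.of A (Fin k → A)) s g hs n ?_
  refine subsingleton_of_forall_eq 0 fun e ↦ ?_
  have hid : ∑ i : Fin k, (ModuleCat.ofHom (LinearMap.proj i : (Fin k → A) →ₗ[A] A) ≫
      ModuleCat.ofHom (LinearMap.single A (fun _ : Fin k ↦ A) i)) =
      𝟙 (ModuleCat.of A (Fin k → A)) := by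
    refine ModuleCat.hom_ext (LinearMap.ext fun x ↦ ?_)
    simp only [ModuleCat.hom_sum, ModuleCat.hom_comp, ModuleCat.hom_ofHom, LinearMap.sum_apply,
      LinearMap.comp_apply, LinearMap.proj_apply, LinearMap.coe_single, ModuleCat.hom_id,
      LinearMap.id_apply]
    exact Finset.univ_sum_single x
  rw [← e.comp_mk₀_id, ← hid, Ext.mk₀_sum, Ext.comp_sum]
  refine Finset.sum_eq_zero fun i _ ↦ ?_
  rw [← Ext.mk₀_comp_mk₀, ← Ext.comp_assoc_of_third_deg_zero,
    Subsingleton.elim (e.comp (Ext.mk₀ (ModuleCat.ofHom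
      (LinearMap.proj i : (Fin k → A) →ₗ[A] A))) (add_zero n)) 0, Ext.zero_comp]

theorem hasInjectiveDimensionLT_of_projective {n : ℕ}
    (hA : HasInjectiveDimensionLT (ModuleCat.of.{u} A A) n) (P : ModuleCat.{u} A)
    [Module.Finite A P] [Module.Projective A P] : HasInjectiveDimensionLT P n := by
  rw [hasInjectiveDimensionLT_iff]
  intro i hi Y e
  have := ext_subsingleton_of_projective (X := Y) (n := i)
    (HasInjectiveDimensionLT.subsingleton _ n i hi Y) P
  exact Subsingleton.elim _ _

/-- A linear map defined on the kernel of `f` extends if the obstruction in `Ext¹` vanishes. -/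
theorem exists_extension_of_ext_one {P M Y : ModuleCat.{u} A} (f : P →ₗ[A] M)
    (hf : Function.Surjective f) (hM : Subsingleton (Ext M Y 1))
    (φ : LinearMap.ker f →ₗ[A] Y) :
    ∃ ψ : P →ₗ[A] Y, ψ ∘ₗ (LinearMap.ker f).subtype = φ := by
  obtain ⟨x, hx⟩ := Ext.contravariant_sequence_exact₁ (LinearMap.shortExact_shortComplexKer hf) Y
    (Ext.mk₀ (ModuleCat.ofHom φ)) (n₁ := 1) rfl (hM.elim _ _)
  obtain ⟨ψ, rfl⟩ := (Ext.mk₀_bijective _ _).2 x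
  rw [Ext.mk₀_comp_mk₀] at hx
  have := (Ext.mk₀_bijective _ _).1 hx
  exact ⟨ψ.hom, congrArg ModuleCat.Hom.hom this⟩

theorem hasProjectiveDimensionLT_one_of_projective (P : ModuleCat.{u} A) [Module.Projective A P] :
    HasProjectiveDimensionLT P 1 :=
  projective_iff_hasProjectiveDimensionLT_one.1 inferInstance

theorem ext_subsingleton_of_injective (X : ModuleCat.{u} A) (I : ModuleCat.{u} A)
    (hI : Module.Injective A I) (n : ℕ) : Subsingleton (Ext X I (n + 1)) := by
  have : Injective I := Module.injective_object_of_injective_module A I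
  exact subsingleton_of_forall_eq 0 fun e ↦ e.eq_zero_of_injective

end ShortExactSequences

/-! ### Global dimension and simple modules -/

section GlobalDimension

variable {A : Type u} [Ring A]

/-- A form of Baer's criterion for the injective dimension. -/
theorem hasInjectiveDimensionLT_of_ext_quotient (n : ℕ) (N : ModuleCat.{u} A)
    (h : ∀ I : Ideal A, Subsingleton (Ext (ModuleCat.of.{u} A (A ⧸ I)) N (n + 1))) :
    HasInjectiveDimensionLT N (n + 1) := by
  induction n generalizing N with
  | zero =>
    have : Module.Injective A N := by
      refine Module.Baer.injective fun I g ↦ ?_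
      obtain ⟨ψ, hψ⟩ := exists_extension_of_ext_one (P := ModuleCat.of A A)
        (M := ModuleCat.of A (A ⧸ I)) I.mkQ (Submodule.mkQ_surjective I) (h I)
        (g ∘ₗ (LinearEquiv.ofEq _ _ I.ker_mkQ).toLinearMap)
      exact ⟨ψ, fun x hx ↦ DFunLike.congr_fun hψ ⟨x, by simpa using hx⟩⟩
    have : Injective N := Module.injective_object_of_injective_module A N
    infer_instance
  | succ n ih =>
    let ⟨I, hI, f, hf⟩ := EnoughInjectives.presentation N
    have hS := shortExact_mkQ f.hom ((ModuleCat.mono_iff_injective f).1 hf)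
    refine hS.hasInjectiveDimensionLT_X₁ (n + 1) (ih _ fun J ↦ ?_)
      (inferInstanceAs (HasInjectiveDimensionLT I (n + 2)))
    -- Dimension shift: $\operatorname{Ext}^{n+1}(A/J,I/N)$ embeds in
    -- $\operatorname{Ext}^{n+2}(A/J,N)$ because $I$ is injective. Here `J` is any left ideal.
    refine subsingleton_of_forall_eq 0 fun e ↦ ?_
    obtain ⟨x, rfl⟩ := Ext.covariant_sequence_exact₃ _ hS e (n₁ := n + 2) rfl ((h J).elim _ _)
    have hx : x = 0 := Ext.eq_zero_of_injective (I := I) x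
    rw [hx, Ext.zero_comp]

theorem hasProjectiveDimensionLT_of_isFiniteLength {n : ℕ}
    (h : ∀ S : ModuleCat.{u} A, IsSimpleModule A S → HasProjectiveDimensionLT S n)
    {M : Type u} [AddCommGroup M] [Module A M] (hM : IsFiniteLength A M) :
    HasProjectiveDimensionLT (ModuleCat.of A M) n := by
  induction hM with
  | @of_subsingleton M _ _ _ =>
    have := (ModuleCat.isZero_of_subsingleton (ModuleCat.of A M)).hasProjectiveDimensionLT_zero
    exact hasProjectiveDimensionLT_of_ge _ 0 _ (Nat.zero_le _)
  | @of_simple_quotient M _ _ N hN _ ih =>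
    have hS := shortExact_ofHom (X := ModuleCat.of A N) (Y := ModuleCat.of A M)
      (Z := ModuleCat.of A (M ⧸ N)) N.subtype N.mkQ N.injective_subtype
      (LinearMap.exact_subtype_mkQ N) N.mkQ_surjective
    exact hS.hasProjectiveDimensionLT_X₂ n ih (h _ hN)

/-- Over a left artinian ring, projective dimensions are bounded by those of the simple modules. -/
theorem hasProjectiveDimensionLT_of_simple [IsArtinianRing A] {n : ℕ}
    (h : ∀ S : ModuleCat.{u} A, IsSimpleModule A S → HasProjectiveDimensionLT S (n + 1))
    (M : ModuleCat.{u} A) : HasProjectiveDimensionLT M (n + 1) := by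
  -- `M` need not have finite length, so the bound is carried through the second variable: the Baer
  -- test for `N` involves only cyclic modules, which do have finite length.
  refine hasProjectiveDimensionLT_of_enoughInjectives M (n + 1) fun N ↦ ?_
  have : HasInjectiveDimensionLT N (n + 1) := by
    refine hasInjectiveDimensionLT_of_ext_quotient n N fun I ↦ ?_
    have := hasProjectiveDimensionLT_of_isFiniteLength h (M := A ⧸ I)
      (isFiniteLength_iff_isNoetherian_isArtinian.2 ⟨inferInstance, inferInstance⟩)
    exact HasProjectiveDimensionLT.subsingleton _ (n + 1) _ le_rfl N
  exact HasInjectiveDimensionLT.subsingleton _ (n + 1) _ le_rfl M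

theorem globalDimension_le_iff (n : ℕ) :
    globalDimension A ≤ n ↔ ∀ M : ModuleCat.{u} A, HasProjectiveDimensionLT M (n + 1) := by
  rw [globalDimension, iSup_le_iff]
  exact forall_congr' fun M ↦ projectiveDimension_le_iff M n

end GlobalDimension

/-! ### Detecting projective dimension by simple modules -/

section SimpleModules

variable {A : Type u} [Ring A]

theorem exists_surjective_to_simple (M : ModuleCat.{u} A) [Module.Finite A M] [Nontrivial M] :
    ∃ (S : ModuleCat.{u} A) (f : M →ₗ[A] S), IsSimpleModule A S ∧ Function.Surjective f := by
  obtain ⟨N, hN, -⟩ := (eq_top_or_exists_le_coatom (⊥ : Submodule A M)).resolve_left bot_ne_top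
  exact ⟨ModuleCat.of A (M ⧸ N), N.mkQ, isSimpleModule_iff_isCoatom.2 hN, N.mkQ_surjective⟩

/-- A finitely generated module `M` over a left artinian ring has projective dimension less than
`n` if `Extⁿ(M, S)` vanishes for all simple `S`. -/
theorem hasProjectiveDimensionLT_of_ext_simple [IsArtinianRing A] (n : ℕ) (M : ModuleCat.{u} A)
    [Module.Finite A M]
    (h : ∀ S : ModuleCat.{u} A, IsSimpleModule A S → Subsingleton (Ext M S n)) :
    HasProjectiveDimensionLT M n := by
  match n, h with
  | 0, h =>
    rcases subsingleton_or_nontrivial M with hM | hM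
    · exact (ModuleCat.isZero_of_subsingleton M).hasProjectiveDimensionLT_zero
    · obtain ⟨S, f, hS, hf⟩ := exists_surjective_to_simple M
      have h0 : ModuleCat.ofHom f = 0 := (Ext.mk₀_eq_zero_iff (ModuleCat.ofHom f)).1
        ((h S hS).elim _ _)
      have h1 : f = 0 := congrArg ModuleCat.Hom.hom h0
      have := hS.nontrivial
      obtain ⟨y, hy⟩ := exists_ne (0 : S)
      obtain ⟨x, rfl⟩ := hf y
      exact absurd (by rw [h1]; rfl) hy
  | 1, h =>
    obtain ⟨P, f, hP, hf⟩ := exists_isProjectiveCover M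
    have := hf.projective
    suffices hk : LinearMap.ker f = ⊥ by
      let e : P ≃ₗ[A] M := LinearEquiv.ofBijective f ⟨LinearMap.ker_eq_bot.1 hk, hf.surjective⟩
      have := Module.Projective.of_equiv e
      exact hasProjectiveDimensionLT_one_of_projective M
    -- A nonzero kernel has a simple quotient `φ`, which extends to `ψ` on `P`. As `φ` is onto, `ker
    -- ψ + ker f = P`, so superfluity forces `ψ = 0`.
    by_contra hk
    have := Submodule.nontrivial_iff_ne_bot.2 hk
    have : Nontrivial (ModuleCat.of A (LinearMap.ker f)) := this
    have : Module.Finite A (ModuleCat.of A (LinearMap.ker f)) :=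
      inferInstanceAs (Module.Finite A (LinearMap.ker f))
    obtain ⟨S, φ, hS, hφ⟩ := exists_surjective_to_simple (ModuleCat.of A (LinearMap.ker f))
    obtain ⟨ψ, hψ⟩ := exists_extension_of_ext_one f hf.surjective (h S hS) φ
    have hker : LinearMap.ker ψ = ⊤ := by
      refine hf.superfluous _ (eq_top_iff.2 fun x _ ↦ ?_)
      obtain ⟨y, hy⟩ := hφ (ψ x)
      have hy' : ψ y.1 = ψ x := by rw [← hy, ← hψ]; rfl
      rw [← sub_add_cancel x y.1]
      exact Submodule.add_mem_sup (by simp [hy']) y.2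
    have := hS.nontrivial
    obtain ⟨z, hz⟩ := exists_ne (0 : S)
    obtain ⟨y, rfl⟩ := hφ z
    apply hz
    rw [← hψ]
    exact LinearMap.mem_ker.1 (hker ▸ Submodule.mem_top : y.1 ∈ LinearMap.ker ψ)
  | n + 2, h =>
    obtain ⟨P, f, hP, hf⟩ := exists_isProjectiveCover M
    have := hf.projective
    have hP1 := hasProjectiveDimensionLT_one_of_projective P
    have hS := LinearMap.shortExact_shortComplexKer hf.surjective
    have : Module.Finite A (ModuleCat.of A (LinearMap.ker f)) :=
      inferInstanceAs (Module.Finite A (LinearMap.ker f))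
    refine hS.hasProjectiveDimensionLT_X₃ (n + 1)
      (hasProjectiveDimensionLT_of_ext_simple (n + 1) (ModuleCat.of A (LinearMap.ker f))
        fun S hSimple ↦ ?_) (hasProjectiveDimensionLT_of_ge P 1 _ (by lia))
    refine subsingleton_of_forall_eq 0 fun e ↦ ?_
    obtain ⟨x, rfl⟩ := Ext.contravariant_sequence_exact₁ hS S e (n₁ := n + 2) (by lia)
      ((h S hSimple).elim _ _)
    have hx : x = 0 := Ext.eq_zero_of_hasProjectiveDimensionLT (X := P) x 1 (by lia)
    rw [hx, Ext.comp_zero]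

theorem isSemisimpleModule_quotient_jacobson [IsArtinianRing A] :
    IsSemisimpleModule A (A ⧸ Ring.jacobson A) :=
  (IsArtinian.isSemisimpleModule_iff_jacobson A (A ⧸ Ring.jacobson A)).2
    (Module.jacobson_quotient_jacobson A A)

/-- Every simple module is a quotient of the semisimple module $A/J$, hence a direct summand of it.
-/
theorem ext_simple_of_ext_quotient_jacobson [IsArtinianRing A] {M : ModuleCat.{u} A} {n : ℕ}
    (h : Subsingleton (Ext M (ModuleCat.of.{u} A (A ⧸ Ring.jacobson A)) n))
    (S : ModuleCat.{u} A) (hS : IsSimpleModule A S) : Subsingleton (Ext M S n) := by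
  have := isSemisimpleModule_quotient_jacobson (A := A)
  obtain ⟨I, hI, ⟨e⟩⟩ := isSimpleModule_iff_quot_maximal.1 hS
  let f : (A ⧸ Ring.jacobson A) →ₗ[A] S :=
    e.symm.toLinearMap ∘ₗ Submodule.factor (Ring.jacobson_le_of_isMaximal I)
  have hf : Function.Surjective f :=
    e.symm.surjective.comp (Submodule.factor_surjective _)
  obtain ⟨s, hs⟩ := IsSemisimpleModule.lifting_property f hf LinearMap.id
  exact ext_subsingleton_of_retract (Z := ModuleCat.of A (A ⧸ Ring.jacobson A)) s f hs n h

theorem hasProjectiveDimensionLT_of_ext_quotient_jacobson [IsArtinianRing A] {n : ℕ}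
    (M : ModuleCat.{u} A) [Module.Finite A M]
    (h : Subsingleton (Ext M (ModuleCat.of.{u} A (A ⧸ Ring.jacobson A)) n)) :
    HasProjectiveDimensionLT M n :=
  hasProjectiveDimensionLT_of_ext_simple n M (ext_simple_of_ext_quotient_jacobson h)

end SimpleModules

/-! ### Injective hulls and minimal coresolutions -/

section InjectiveHull

variable {A : Type u} [Ring A]

theorem exists_maximal_essential_extension {I : Type u} [AddCommGroup I] [Module A I]
    (N : Submodule A I) :
    ∃ E : Submodule A I, Maximal
      (fun E ↦ N ≤ E ∧ ∀ K : Submodule A I, K ≤ E → K ⊓ N = ⊥ → K = ⊥) E := by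
  refine (zorn_le_nonempty₀
    {E : Submodule A I | N ≤ E ∧ ∀ K : Submodule A I, K ≤ E → K ⊓ N = ⊥ → K = ⊥}
    (fun c hc hchain E₀ hE₀ ↦ ?_) N
    ⟨le_rfl, fun K hK h ↦ by rwa [inf_eq_left.2 hK] at h⟩).imp fun E hE ↦ hE.2
  refine ⟨sSup c, ⟨(hc hE₀).1.trans (le_sSup hE₀), fun K hK h ↦ ?_⟩, fun E hE ↦ le_sSup hE⟩
  rw [eq_bot_iff]
  intro x hx
  obtain ⟨E, hE, hxE⟩ := (Submodule.mem_sSup_of_directed ⟨E₀, hE₀⟩ hchain.directedOn).1 (hK hx)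
  have hspan : Submodule.span A {x} ≤ K := by simpa using hx
  have := (hc hE).2 (Submodule.span A {x}) (by simpa using hxE)
    (eq_bot_iff.2 ((inf_le_inf_right N hspan).trans h.le))
  simpa using this

theorem injective_of_retract {I E : Type u} [AddCommGroup I] [Module A I] [AddCommGroup E]
    [Module A E] (hI : Module.Injective A I) (i : E →ₗ[A] I) (r : I →ₗ[A] E)
    (h : ∀ x, r (i x) = x) : Module.Injective A E where
  out X Y _ _ _ _ f hf g := by
    obtain ⟨φ, hφ⟩ := hI.out f hf (i ∘ₗ g)
    exact ⟨r ∘ₗ φ, fun x ↦ by simp [hφ, h]⟩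

theorem exists_maximal_disjoint {I : Type u} [AddCommGroup I] [Module A I] (E : Submodule A I) :
    ∃ C : Submodule A I, Maximal (fun C ↦ C ⊓ E = ⊥) C := by
  refine (zorn_le_nonempty₀ {C : Submodule A I | C ⊓ E = ⊥}
    (fun c hc hchain C₀ hC₀ ↦ ?_) ⊥ (bot_inf_eq E)).imp fun C hC ↦ hC.2
  refine ⟨sSup c, ?_, fun C hC ↦ le_sSup hC⟩
  refine eq_bot_iff.2 fun x hx ↦ ?_
  obtain ⟨C, hC, hxC⟩ := (Submodule.mem_sSup_of_directed ⟨C₀, hC₀⟩ hchain.directedOn).1 hx.1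
  exact (hc hC).le ⟨hxC, hx.2⟩

/-- A maximal essential extension inside an injective module is injective. -/
theorem injective_of_maximal_essential {I : Type u} [AddCommGroup I] [Module A I]
    (hI : Module.Injective A I) {N E : Submodule A I}
    (hE : Maximal (fun E ↦ N ≤ E ∧ ∀ K : Submodule A I, K ≤ E → K ⊓ N = ⊥ → K = ⊥) E) :
    Module.Injective A E := by
  -- Maximality of `C` makes `E` essential in `I ⧸ C`. The inclusion of `E` extends to `g : I ⧸ C →
  -- I`, injective by essentiality; its range is essential over `N`, so equals `E`, which makes `E`
  -- a retract of `I`.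
  obtain ⟨C, hC⟩ := exists_maximal_disjoint E
  have hCE : C ⊓ E = ⊥ := hC.prop
  let π : E →ₗ[A] I ⧸ C := C.mkQ ∘ₗ E.subtype
  have hπ : Function.Injective π := by
    rw [← LinearMap.ker_eq_bot, eq_bot_iff]
    intro x hx
    have hxC : x.1 ∈ C := by simpa [π] using hx
    exact Subtype.ext ((Submodule.mem_bot A).1 (hCE.le ⟨hxC, x.2⟩))
  obtain ⟨g, hg⟩ := hI.out π hπ E.subtype
  -- the image of `E` in `I ⧸ C` is essential
  have hess : ∀ L : Submodule A (I ⧸ C), L ⊓ LinearMap.range π = ⊥ → L = ⊥ := by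
    intro L hL
    have hle : C ≤ L.comap C.mkQ := fun x hx ↦ by
      simp [(Submodule.Quotient.mk_eq_zero C).2 hx]
    have hdis : L.comap C.mkQ ⊓ E = ⊥ := by
      refine eq_bot_iff.2 fun x hx ↦ ?_
      have h0 : C.mkQ x = 0 := (Submodule.mem_bot A).1
        (hL.le ⟨hx.1, ⟨⟨x, hx.2⟩, rfl⟩⟩)
      exact hCE.le ⟨by simpa using h0, hx.2⟩
    have heq : L.comap C.mkQ ≤ C := hC.le_of_ge hdis hle
    refine eq_bot_iff.2 fun y hy ↦ ?_
    obtain ⟨x, rfl⟩ := C.mkQ_surjective y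
    simpa using heq hy
  have hginj : LinearMap.ker g = ⊥ := by
    refine hess _ (eq_bot_iff.2 ?_)
    rintro _ ⟨hy, x, rfl⟩
    have : E.subtype x = 0 := by rw [← hg]; exact hy
    have hx : x = 0 := Subtype.ext this
    simp [hx]
  have hEg : E ≤ LinearMap.range g := fun x hx ↦ ⟨π ⟨x, hx⟩, hg ⟨x, hx⟩⟩
  have hgE : LinearMap.range g ≤ E := by
    refine hE.le_of_ge ⟨hE.prop.1.trans hEg, fun K hK hKN ↦ ?_⟩ hEg
    have hKE : K ⊓ E = ⊥ := hE.prop.2 _ inf_le_right (by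
      rw [inf_assoc, inf_eq_right.2 hE.prop.1, hKN])
    have hbot : K.comap g = ⊥ := by
      refine hess _ (eq_bot_iff.2 ?_)
      rintro _ ⟨hy, x, rfl⟩
      have hxK : x.1 ∈ K := by rw [show x.1 = g (π x) from (hg x).symm]; exact hy
      have hx : x = 0 := Subtype.ext ((Submodule.mem_bot A).1 (hKE.le ⟨hxK, x.2⟩))
      simp [hx]
    refine eq_bot_iff.2 fun x hx ↦ ?_
    obtain ⟨y, rfl⟩ := hK hx
    have hy : y = 0 := (Submodule.mem_bot A).1 (hbot.le hx)
    simp [hy]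
  exact injective_of_retract hI E.subtype
    ((g ∘ₗ C.mkQ).codRestrict E fun x ↦ hgE ⟨C.mkQ x, rfl⟩) fun x ↦ Subtype.ext (hg x)

/-- Every module has an injective hull. -/
theorem exists_injective_hull (M : ModuleCat.{u} A) :
    ∃ (E : ModuleCat.{u} A) (ι : M →ₗ[A] E), Module.Injective A E ∧ Function.Injective ι ∧
      IsEssentialSubmodule (LinearMap.range ι) := by
  let ⟨I, hI, f, hf⟩ := EnoughInjectives.presentation M
  have hI' : Module.Injective A I := Module.injective_module_of_injective_object A I
  have hinj : Function.Injective f.hom := (ModuleCat.mono_iff_injective f).1 hf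
  obtain ⟨E, hE⟩ := exists_maximal_essential_extension (LinearMap.range f.hom)
  refine ⟨ModuleCat.of A E, f.hom.codRestrict E fun x ↦ hE.prop.1 ⟨x, rfl⟩,
    injective_of_maximal_essential hI' hE, fun x y h ↦ hinj (congrArg Subtype.val h), ?_⟩
  intro K hK
  have hbot : Submodule.map E.subtype K = ⊥ := by
    refine hE.prop.2 _ (Submodule.map_subtype_le E K) (eq_bot_iff.2 ?_)
    rintro _ ⟨⟨y, hy, rfl⟩, x, hx⟩
    have hy0 : y = 0 := (Submodule.mem_bot A).1 (hK.le ⟨hy, x, Subtype.ext hx⟩)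
    simp [hy0]
  exact Submodule.map_injective_of_injective E.injective_subtype
    (hbot.trans (Submodule.map_bot _).symm)

/-- Every module has a minimal injective coresolution. -/
theorem nonempty_minimalInjectiveCoresolution (M : ModuleCat.{u} A) :
    Nonempty (MinimalInjectiveCoresolution M) := by
  choose E ι hE hι hess using exists_injective_hull (A := A)
  let N (Z : ModuleCat.{u} A) : Submodule A (E Z) := LinearMap.range (ι Z)
  -- `Z n` is the `n`-th cosyzygy of `M`.
  let Z : ℕ → ModuleCat.{u} A := Nat.rec M fun _ Z ↦ ModuleCat.of A (E Z ⧸ N Z)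
  let q (n : ℕ) : E (Z n) →ₗ[A] Z (n + 1) := (N (Z n)).mkQ
  have hq (n : ℕ) : Function.Surjective (q n) := (N (Z n)).mkQ_surjective
  have hrange (n : ℕ) : LinearMap.range (ι (Z (n + 1)) ∘ₗ q n) = N (Z (n + 1)) :=
    LinearMap.range_comp_of_range_eq_top _ (LinearMap.range_eq_top.2 (hq n))
  have hker (n : ℕ) : LinearMap.ker (ι (Z (n + 1)) ∘ₗ q n) = N (Z n) := by
    rw [LinearMap.ker_comp_of_ker_eq_bot _ (LinearMap.ker_eq_bot.2 (hι _))]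
    exact (N (Z n)).ker_mkQ
  exact ⟨{
    I := fun n ↦ E (Z n)
    ι := ι M
    d := fun n ↦ ι (Z (n + 1)) ∘ₗ q n
    injective := fun n ↦ hE _
    ι_injective := hι M
    exact_zero := LinearMap.exact_iff.2 (hker 0)
    exact_succ := fun n ↦ LinearMap.exact_iff.2 ((hker (n + 1)).trans (hrange n).symm)
    essential_zero := hess M
    essential_succ := fun n ↦ by rw [hrange]; exact hess _ }⟩

end InjectiveHull

/-! ### Ext from simple modules through the coresolution -/

section Coresolution

variable {A : Type u} [Ring A]

/-- If `S` admits no nonzero maps to the first `n` terms of an injective coresolution of `M`, then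
`Extⁱ(S, M) = 0` for `i < n`. -/
theorem MinimalInjectiveCoresolution.ext_subsingleton {M : ModuleCat.{u} A}
    (c : MinimalInjectiveCoresolution M) (S : ModuleCat.{u} A) (n : ℕ)
    (h : ∀ k < n, ∀ f : S →ₗ[A] c.I k, f = 0) (i : ℕ) (hi : i < n) : Subsingleton (Ext S M i) := by
  -- Generalised to every cosyzygy, so that the induction can trade one Ext degree for one step
  -- along the coresolution.
  suffices key : ∀ (i k : ℕ) (N : ModuleCat.{u} A) (f : N →ₗ[A] c.I k), i + k < n →
      Function.Injective f → Function.Exact f (c.d k) → Subsingleton (Ext S N i) from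
    key i 0 M c.ι hi c.ι_injective c.exact_zero
  intro i
  induction i with
  | zero =>
    intro k N f hk hf _
    refine subsingleton_of_forall_eq 0 fun e ↦ ?_
    obtain ⟨g, rfl⟩ := (Ext.mk₀_bijective _ _).2 e
    have hg : g = 0 := by
      ext x
      exact hf ((DFunLike.congr_fun (h k (by lia) (f ∘ₗ g.hom)) x).trans (map_zero f).symm)
    rw [hg, Ext.mk₀_zero]
  | succ i ih =>
    intro k N f hk hf hexact
    let Z : ModuleCat.{u} A := ModuleCat.of A (LinearMap.range (c.d k))
    have hS := shortExact_ofHom (Z := Z) f (c.d k).rangeRestrict hf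
      (by rw [LinearMap.exact_iff, LinearMap.ker_rangeRestrict]; exact hexact.linearMap_ker_eq)
      (c.d k).surjective_rangeRestrict
    have hZ := ih (k + 1) Z (LinearMap.range (c.d k)).subtype (by lia) (Submodule.injective_subtype _)
      (by rw [LinearMap.exact_iff, Submodule.range_subtype]
          exact (c.exact_succ k).linearMap_ker_eq)
    refine subsingleton_of_forall_eq 0 fun e ↦ ?_
    obtain ⟨x, rfl⟩ := Ext.covariant_sequence_exact₁ S hS e
      ((ext_subsingleton_of_injective S (c.I k) (c.injective k) i).elim _ _) rfl
    rw [hZ.elim x 0, Ext.zero_comp]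

theorem MinimalInjectiveCoresolution.projective_of_lt_dominantDimension {M : ModuleCat.{u} A}
    (c : MinimalInjectiveCoresolution M) {k : ℕ} (hk : (k : ℕ∞) < dominantDimension M) :
    Module.Projective A (c.I k) := by
  by_contra h
  exact hk.not_ge (sInf_le ⟨k, rfl, c, h⟩)

/-- A simple submodule of a projective module does not have the largest possible finite
projective dimension, unless the latter is `0`. -/
theorem eq_zero_of_simple_of_projective {n : ℕ}
    (hA : ∀ M : ModuleCat.{u} A, HasProjectiveDimensionLT M (n + 1)) {S Q : ModuleCat.{u} A}
    [IsSimpleModule A S] (hS : ¬ HasProjectiveDimensionLT S n) (hn : 0 < n)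
    [Module.Projective A Q] (f : S →ₗ[A] Q) : f = 0 := by
  by_contra hf
  have hseq := shortExact_mkQ f (LinearMap.injective_of_ne_zero hf)
  have hQ := hasProjectiveDimensionLT_one_of_projective Q
  exact hS (hseq.hasProjectiveDimensionLT_X₁ n (hasProjectiveDimensionLT_of_ge Q 1 n hn) (hA _))

end Coresolution

/-! ### Syzygies and dimension shifting -/

section Syzygies

variable {A : Type u} [Ring A]

theorem IsProjectiveCover.finite {P M : Type u} [AddCommGroup P] [Module A P] [AddCommGroup M]
    [Module A M] {f : P →ₗ[A] M} (hf : IsProjectiveCover f) [Module.Finite A M] :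
    Module.Finite A P := by
  obtain ⟨n, g, hg⟩ := Module.Finite.exists_fin' A M
  obtain ⟨h, hh⟩ := Module.projective_lifting_property f g hf.surjective
  have htop : LinearMap.range h = ⊤ := by
    refine hf.superfluous _ (eq_top_iff.2 fun x _ ↦ ?_)
    obtain ⟨y, hy⟩ := hg (f x)
    have hy' : f (h y) = f x := by rw [← hy, ← hh]; rfl
    rw [← sub_add_cancel x (h y), add_comm]
    exact Submodule.add_mem_sup ⟨y, rfl⟩ (by simp [hy'])
  exact Module.Finite.of_surjective h (LinearMap.range_eq_top.1 htop)

theorem IsProjectiveCover.ker_eq_bot {P M : Type u} [AddCommGroup P] [Module A P] [AddCommGroup M]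
    [Module A M] {f : P →ₗ[A] M} (hf : IsProjectiveCover f) [Module.Projective A M] :
    LinearMap.ker f = ⊥ := by
  obtain ⟨s, hs⟩ := Module.projective_lifting_property f LinearMap.id hf.surjective
  have hs' : ∀ y, f (s y) = y := DFunLike.congr_fun hs
  have htop : LinearMap.range s = ⊤ := by
    refine hf.superfluous _ (eq_top_iff.2 fun x _ ↦ ?_)
    rw [← sub_add_cancel x (s (f x)), add_comm]
    exact Submodule.add_mem_sup ⟨f x, rfl⟩ (by simp [hs'])
  refine eq_bot_iff.2 fun x hx ↦ ?_
  obtain ⟨y, rfl⟩ := LinearMap.range_eq_top.1 htop x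
  have hy : y = 0 := (hs' y).symm.trans hx
  simp [hy]

/-- The step from one syzygy of a finitely generated module to the next. -/
theorem IsSyzygy.exists_shortExact {n : ℕ} {M K : ModuleCat.{u} A} (hK : IsSyzygy (n + 1) M K) :
    ∃ (L P : ModuleCat.{u} A) (f : P →ₗ[A] L) (i : K →ₗ[A] P), IsSyzygy n M L ∧
      IsProjectiveCover f ∧ Function.Injective i ∧ Function.Exact i f := by
  obtain ⟨L, P, f, hL, hf, ⟨e⟩⟩ := hK
  refine ⟨L, P, f, (LinearMap.ker f).subtype ∘ₗ e.toLinearMap, hL, hf,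
    (LinearMap.ker f).injective_subtype.comp e.injective, ?_⟩
  rw [LinearMap.exact_iff, LinearMap.range_comp, e.range, Submodule.map_top,
    Submodule.range_subtype]

theorem IsSyzygy.finite [IsNoetherianRing A] {n : ℕ} {M K : ModuleCat.{u} A} [Module.Finite A M]
    (hK : IsSyzygy n M K) : Module.Finite A K := by
  induction n generalizing K with
  | zero =>
    obtain ⟨e⟩ := hK
    exact Module.Finite.equiv e.symm
  | succ n ih =>
    obtain ⟨L, P, f, i, hL, hf, hi, -⟩ := hK.exists_shortExact
    have := ih hL
    have := hf.finite
    exact Module.Finite.of_injective i hi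

theorem IsSyzygy.hasProjectiveDimensionLT {n m : ℕ} (hm : 0 < m) {M K : ModuleCat.{u} A}
    (hK : IsSyzygy n M K) (hM : HasProjectiveDimensionLT M (m + n)) :
    HasProjectiveDimensionLT K m := by
  induction n generalizing K m with
  | zero =>
    obtain ⟨e⟩ := hK
    exact hasProjectiveDimensionLT_of_iso (X := M) e.symm.toModuleIso m
  | succ n ih =>
    obtain ⟨L, P, f, i, hL, hf, hi, hexact⟩ := hK.exists_shortExact
    have := hf.projective
    have hP := hasProjectiveDimensionLT_one_of_projective P
    exact (shortExact_ofHom i f hi hexact hf.surjective).hasProjectiveDimensionLT_X₁ m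
      (hasProjectiveDimensionLT_of_ge P 1 m hm)
      (ih (Nat.succ_pos m) hL (by rwa [show m + 1 + n = m + (n + 1) by lia]))

/-- The preceding syzygy is already projective, and minimality makes its projective cover an
isomorphism. -/
theorem IsSyzygy.subsingleton {n : ℕ} {M K : ModuleCat.{u} A} (hK : IsSyzygy n M K)
    (hM : HasProjectiveDimensionLT M n) : Subsingleton K := by
  cases n with
  | zero =>
    obtain ⟨e⟩ := hK
    have := ModuleCat.subsingleton_of_isZero (isZero_of_hasProjectiveDimensionLT_zero M)
    exact e.subsingleton
  | succ n =>
    obtain ⟨L, P, f, i, hL, hf, hi, hexact⟩ := hK.exists_shortExact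
    have := hL.hasProjectiveDimensionLT Nat.one_pos (by rwa [add_comm] at hM)
    have : Projective L := projective_iff_hasProjectiveDimensionLT_one.2 this
    have : Module.Projective A L := inferInstance
    refine ⟨fun x y ↦ hi ?_⟩
    have h (z : K) : i z = 0 := by
      have : i z ∈ LinearMap.ker f := hexact.apply_apply_eq_zero z
      rwa [hf.ker_eq_bot, Submodule.mem_bot] at this
    rw [h, h]

/-- If `A` has finite injective dimension, then finiteness of the injective dimension of a syzygy
of a finitely generated module is inherited by the module. -/
theorem IsSyzygy.exists_hasInjectiveDimensionLT [IsNoetherianRing A] {m : ℕ}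
    (hA : HasInjectiveDimensionLT (ModuleCat.of.{u} A A) m) {n : ℕ} {M K : ModuleCat.{u} A}
    [Module.Finite A M] (hK : IsSyzygy n M K) (h : ∃ k, HasInjectiveDimensionLT K k) :
    ∃ k, HasInjectiveDimensionLT M k := by
  induction n generalizing K with
  | zero =>
    obtain ⟨e⟩ := hK
    obtain ⟨k, hk⟩ := h
    exact ⟨k, hasInjectiveDimensionLT_of_iso (X := K) e.toModuleIso k⟩
  | succ n ih =>
    obtain ⟨L, P, f, i, hL, hf, hi, hexact⟩ := hK.exists_shortExact
    obtain ⟨k, hk⟩ := h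
    have := hL.finite
    have := hf.finite
    have := hf.projective
    have hP := hasInjectiveDimensionLT_of_projective hA P
    exact ih hL ⟨max m k, (shortExact_ofHom i f hi hexact hf.surjective).hasInjectiveDimensionLT_X₃
      (max m k) (hasInjectiveDimensionLT_of_ge P m _ (le_max_left _ _))
      (hasInjectiveDimensionLT_of_ge K k _ (by lia))⟩

/-- If `Extⁱ(S, A)` vanishes in the relevant range, then nonvanishing of `Ext` passes from a
finitely generated module to its syzygies. -/
theorem IsSyzygy.not_subsingleton_ext [IsNoetherianRing A] {n j : ℕ} {M K S : ModuleCat.{u} A}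
    [Module.Finite A M] (hK : IsSyzygy n M K)
    (hA : ∀ i < j + n, Subsingleton (Ext S (ModuleCat.of.{u} A A) i))
    (hM : ¬ Subsingleton (Ext S M j)) : ¬ Subsingleton (Ext S K (j + n)) := by
  induction n generalizing K with
  | zero =>
    obtain ⟨e⟩ := hK
    exact fun h ↦ hM ((ext_subsingleton_congr_right e j).1 h)
  | succ n ih =>
    obtain ⟨L, P, f, i, hL, hf, hi, hexact⟩ := hK.exists_shortExact
    intro h
    have := hL.finite
    have := hf.finite
    have := hf.projective
    have hP := ext_subsingleton_of_projective (hA (j + n) (by lia)) P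
    refine ih hL (fun i hi ↦ hA i (by lia)) (subsingleton_of_forall_eq 0 fun e ↦ ?_)
    obtain ⟨x, rfl⟩ := Ext.covariant_sequence_exact₃ S
      (shortExact_ofHom i f hi hexact hf.surjective) e (n₁ := j + n + 1) rfl (h.elim _ _)
    rw [hP.elim x 0, Ext.zero_comp]

end Syzygies

/-! ### The minimal Auslander–Gorenstein case -/

section MinimalAuslanderGorenstein

variable {A : Type u} [Ring A]

theorem hasInjectiveDimensionLT_of_forall_hasProjectiveDimensionLT {n : ℕ}
    (hA : ∀ M : ModuleCat.{u} A, HasProjectiveDimensionLT M n) (N : ModuleCat.{u} A) :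
    HasInjectiveDimensionLT N n := by
  rw [hasInjectiveDimensionLT_iff]
  intro i hi Y e
  have := hA Y
  exact e.eq_zero_of_hasProjectiveDimensionLT n hi

/-- If a finitely generated module over a left artinian ring of global dimension at most `n` has
projective dimension `n`, then `A` has injective dimension at least `n`. -/
theorem not_hasInjectiveDimensionLT_self [IsArtinianRing A] {n : ℕ}
    (hA : ∀ M : ModuleCat.{u} A, HasProjectiveDimensionLT M (n + 1)) {M : ModuleCat.{u} A}
    [Module.Finite A M] (hM : ¬ HasProjectiveDimensionLT M n) :
    ¬ HasInjectiveDimensionLT (ModuleCat.of.{u} A A) n := by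
  intro h
  refine hM (hasProjectiveDimensionLT_of_ext_quotient_jacobson M
    (subsingleton_of_forall_eq 0 fun e ↦ ?_))
  -- $\operatorname{Ext}^n(M,A)\to\operatorname{Ext}^n(M,A/J)$ is onto, since
  -- $\operatorname{Ext}^{n+1}(M,J)=0$.
  have hS := LinearMap.shortExact_shortComplexKer (Submodule.mkQ_surjective (Ring.jacobson A))
  have := hA M
  obtain ⟨x, rfl⟩ := Ext.covariant_sequence_exact₃ M hS e (n₁ := n + 1) rfl
    (Ext.eq_zero_of_hasProjectiveDimensionLT _ (n + 1) le_rfl)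
  rw [(HasInjectiveDimensionLT.subsingleton (ModuleCat.of.{u} A A) n n le_rfl M).elim x 0,
    Ext.zero_comp]

/-- Over a minimal Auslander–Gorenstein left artinian ring of global dimension at most `n`, a simple
module `S` of projective dimension `n` satisfies `Extⁱ(S, A) = 0` for `i < n`. -/
theorem IsMinimalAuslanderGorenstein.ext_self_subsingleton [IsArtinianRing A]
    (h : IsMinimalAuslanderGorenstein A) {n : ℕ}
    (hA : ∀ M : ModuleCat.{u} A, HasProjectiveDimensionLT M (n + 1)) {S : ModuleCat.{u} A}
    [IsSimpleModule A S] (hS : ¬ HasProjectiveDimensionLT S n) (i : ℕ) (hi : i < n) :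
    Subsingleton (Ext S (ModuleCat.of.{u} A A) i) := by
  obtain ⟨c⟩ := nonempty_minimalInjectiveCoresolution (ModuleCat.of.{u} A A)
  refine c.ext_subsingleton S n (fun k hk f ↦ ?_) i hi
  have hdom : ((n : ℕ∞) : WithBot ℕ∞) ≤ (dominantDimension (ModuleCat.of.{u} A A) : ℕ∞) :=
    ((injectiveDimension_ge_iff _ n).2 (not_hasInjectiveDimensionLT_self hA hS)).trans
      h.injectiveDimension_le
  have hk' : (k : ℕ∞) < n := by exact_mod_cast hk
  have := c.projective_of_lt_dominantDimension (hk'.trans_le (WithBot.coe_le_coe.1 hdom))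
  exact eq_zero_of_simple_of_projective hA hS (by lia) f

end MinimalAuslanderGorenstein

theorem theorem4p5 {R : Type*} [CommRing R] [IsArtinianRing R] {A : Type u} [Ring A] [Algebra R A]
    [Module.Finite R A] (hA : IsMinimalAuslanderGorenstein A) (n : ℕ) (K : ModuleCat.{u} A)
    (hK : IsSyzygy n (ModuleCat.of.{u} A (A ⧸ Ring.jacobson A)) K) (hK0 : Nontrivial K) :
    injectiveDimension K = globalDimension A := by
  have : IsArtinianRing A := IsArtinianRing.of_finite R A
  have : Module.Finite A (ModuleCat.of.{u} A (A ⧸ Ring.jacobson A)) :=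
    inferInstanceAs (Module.Finite A (A ⧸ Ring.jacobson A))
  have hle (d : ℕ) (hd : globalDimension A ≤ d) : injectiveDimension K ≤ d :=
    (injectiveDimension_le_iff K d).2
      (hasInjectiveDimensionLT_of_forall_hasProjectiveDimensionLT
        ((globalDimension_le_iff d).1 hd) K)
  obtain ⟨m, hm⟩ := (injectiveDimension_ne_top_iff _).1 hA.gorenstein.left.ne
  rcases eq_or_ne (globalDimension A) ⊤ with htop | htop
  · rw [htop]
    by_contra hne
    obtain ⟨k, hk⟩ := (injectiveDimension_ne_top_iff K).1 hne
    obtain ⟨l, hl⟩ := hK.exists_hasInjectiveDimensionLT hm ⟨_, hk⟩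
    have hglobal : globalDimension A ≤ l := by
      refine (globalDimension_le_iff l).2 (hasProjectiveDimensionLT_of_simple fun S hS ↦ ?_)
      exact hasProjectiveDimensionLT_of_ext_quotient_jacobson S
        (HasInjectiveDimensionLT.subsingleton _ l _ (Nat.le_succ l) S)
    rw [htop, top_le_iff] at hglobal
    exact ENat.natCast_ne_top l (WithBot.coe_eq_coe.1 hglobal)
  · obtain ⟨d, hd⟩ : ∃ d : ℕ, globalDimension A = d := by
      have hK' : projectiveDimension K ≠ ⊥ := fun h ↦ by
        have := ModuleCat.subsingleton_of_isZero ((projectiveDimension_eq_bot_iff K).1 h)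
        exact not_subsingleton K this
      have hbot : globalDimension A ≠ ⊥ := fun h ↦
        hK' (le_bot_iff.1 (h ▸ le_iSup (fun M : ModuleCat.{u} A ↦ projectiveDimension M) K))
      obtain ⟨e, he⟩ := WithBot.ne_bot_iff_exists.1 hbot
      rw [← he] at htop ⊢
      obtain ⟨d, rfl⟩ := ENat.ne_top_iff_exists.1 (show e ≠ ⊤ from fun h ↦ htop (by rw [h]; rfl))
      exact ⟨d, rfl⟩
    have hpd := (globalDimension_le_iff d).1 hd.le
    refine le_antisymm (hd ▸ hle d hd.le) (hd ▸ (injectiveDimension_ge_iff K d).2 fun hlt ↦ ?_)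
    -- Needed for `d - n` below to be a genuine difference.
    have hnd : n ≤ d := by
      by_contra! hlt
      exact not_subsingleton K
        (hK.subsingleton (hasProjectiveDimensionLT_of_ge _ (d + 1) n hlt))
    obtain ⟨S, hS, hSd⟩ : ∃ S : ModuleCat.{u} A, IsSimpleModule A S ∧
        ¬ HasProjectiveDimensionLT S d := by
      by_contra! h
      -- For `d = 0` the negated claim says that every simple module is zero; otherwise it lowers
      -- the global dimension.
      obtain _ | d := d
      · have : Nontrivial A := Module.nontrivial A K
        have : Nontrivial (ModuleCat.of A A) := this
        obtain ⟨S, -, hS, -⟩ := exists_surjective_to_simple (ModuleCat.of.{u} A A)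
        have := h S hS
        have := hS.nontrivial
        exact not_subsingleton S
          (ModuleCat.subsingleton_of_isZero (isZero_of_hasProjectiveDimensionLT_zero S))
      · have := (globalDimension_le_iff d).2 (hasProjectiveDimensionLT_of_simple h)
        rw [hd] at this
        exact absurd (Nat.cast_le.1 this) (by lia)
    refine hK.not_subsingleton_ext (j := d - n) (S := S) (fun i hi ↦ ?_) (fun h ↦ ?_) ?_
    · exact hA.ext_self_subsingleton hpd hSd i (by lia)
    · have := hasProjectiveDimensionLT_of_ext_quotient_jacobson S h
      exact hSd (hasProjectiveDimensionLT_of_ge S (d - n) d (Nat.sub_le d n))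
    · exact HasInjectiveDimensionLT.subsingleton K d _ (by lia) S
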